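/- Theorem 1.13. Let $p$ be a prime and let $k\ge 1$ and $n\ge 2$ be integers. For $m\ge 1$ put $d_m:=\gcd(k,p^m-1)$, and let $d:=d_1$. Let $M_n(\mathbb F_p)$ be the ring of $n\times n$ matrices over the field $\mathbb F_p$ with $p$ elements, let $GL_n(\mathbb F_p)$ be its group of invertible elements, and let $$P:=\{A^k+B^k\mid A,B\in M_n(\mathbb F_p)\},\qquad Q:=\{A^k+B^k\mid A,B\in GL_n(\mathbb F_p)\}.$$ Suppose that $p>d+1$ and $p\nmid k$. Then the following hold, where $\ln 0:=-\infty$ (this is needed only for $k=1$). (a) If $n>\max\left\{\frac{p-1}{2},\frac{4\ln(k-1)}{\ln p}\right\}$, then $P=M_n(\mathbb F_p)$. (b) If $n>\max\left\{\frac{p-1}{2},\frac{\ln\left((k-1)^4+4k\right)}{\ln p}\right\}$ and $p\,\frac{p^n-1}{d_n}$ is even, then $Q=M_n(\mathbb F_p)$. -/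

import Mathlib

/-- The set `P` of all sums `A ^ k + B ^ k` with `A`, `B` arbitrary `n × n` matrices over `R`. -/
def sumTwoPowers (k n : ℕ) (R : Type*) [CommRing R] : Set (Matrix (Fin n) (Fin n) R) :=
  {M | ∃ A B : Matrix (Fin n) (Fin n) R, M = A ^ k + B ^ k}

/-- The set `Q` of all sums `A ^ k + B ^ k` with `A`, `B` invertible `n × n` matrices over `R`. -/
def sumTwoInvertiblePowers (k n : ℕ) (R : Type*) [CommRing R] :
    Set (Matrix (Fin n) (Fin n) R) :=
  {M | ∃ A B : Matrix (Fin n) (Fin n) R, IsUnit A ∧ IsUnit B ∧ M = A ^ k + B ^ k}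

/-- The number `d_m = gcd (k, q ^ m - 1)`; the subtraction is a true one for `q ≥ 1`. -/
def powGcd (k q m : ℕ) : ℕ := Nat.gcd k (q ^ m - 1)

/-!
A non-scalar matrix over a field is conjugate to one with any prescribed diagonal of the same trace
(Fillmore). When `n > (p - 1) / 2`, every element of `𝔽_p` is a sum of `2n` nonzero `k`-th powers,
each of them `1` or a fixed `k`-th power `r ^ k ≠ 1`, so the conjugate can be split into an upper
and a lower triangular matrix whose diagonal entries are nonzero `k`-th powers. A triangular matrix
`T` of this kind is a `k`-th power: if `f` is its characteristic polynomial, then `X` has a `k`-th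
root modulo the radical of `f` by interpolation, hence modulo `f` by Hensel lifting since `p ∤ k`,
and evaluating this root at `T` gives a `k`-th root of `T`.

For a scalar matrix `c`, embed the field with `p ^ n` elements into the matrices by its regular
representation and write `c` as a sum of two `k`-th powers there. Counting the solutions of
`x ^ k + y ^ k = c` by Jacobi sums shows that they exist once `p ^ n` is large enough; when nonzero
`x` and `y` are required, `c = 0` has to be treated apart and means that `-1` is a `k`-th power.
-/

section Diagonal

open Matrix

variable {ι K : Type*} [Fintype ι] [DecidableEq ι]

lemma trace_eq_of_isConj [CommRing K] {A B : Matrix ι ι K} (h : IsConj A B) :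
    A.trace = B.trace := by
  obtain ⟨c, hc⟩ := h
  rw [← trace_units_conj c A, hc.eq, mul_assoc, Units.mul_inv, mul_one]

/-- The conjugate of `A` by the transvection `1 + c Eᵢⱼ`: it adds `c` times row `j` to row `i`, and
then subtracts `c` times column `i` from column `j`. -/
def transvectionConj [CommRing K] (i j : ι) (c : K) (A : Matrix ι ι K) : Matrix ι ι K :=
  transvection i j c * A * transvection i j (-c)

lemma isConj_transvectionConj [CommRing K] {i j : ι} (hij : i ≠ j) (c : K) (A : Matrix ι ι K) :
    IsConj A (transvectionConj i j c A) := by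
  have hinv (d : K) : transvection i j d * transvection i j (-d) = 1 := by
    rw [transvection_mul_transvection_same i j hij, add_neg_cancel, transvection_zero]
  refine ⟨⟨transvection i j c, transvection i j (-c), hinv c, by simpa using hinv (-c)⟩, ?_⟩
  simp only [SemiconjBy, transvectionConj, mul_assoc, mul_eq_one_comm.mp (hinv c), mul_one]

variable [Field K]

lemma exists_isConj_apply_ne_zero {A : Matrix ι ι K} (hA : A ∉ Set.range (scalar ι)) :
    ∃ B i j, IsConj A B ∧ i ≠ j ∧ B i j ≠ 0 := by
  by_contra! hdiag
  have hoff {i j : ι} (hij : i ≠ j) : A i j = 0 := hdiag A i j (.refl A) hij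
  have heq {i j : ι} (hij : i ≠ j) : A i i = A j j := by
    have h := hdiag _ i j (isConj_transvectionConj hij 1 A) hij
    simp only [transvectionConj, mul_transvection_apply_same, transvection_mul_apply_same,
      hoff hij, hoff hij.symm] at h
    linear_combination -h
  rcases isEmpty_or_nonempty ι with _ | ⟨⟨i⟩⟩
  · exact hA ⟨0, Subsingleton.elim _ _⟩
  refine hA ⟨A i i, ?_⟩
  ext l m
  obtain rfl | hlm := eq_or_ne l m
  · obtain rfl | hil := eq_or_ne i l
    · simp
    · simpa using heq hil
  · simp [hlm, hoff hlm]

lemma exists_isConj_apply_self_eq {A : Matrix ι ι K} {i j : ι} (hij : i ≠ j) (hA : A i j ≠ 0)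
    (t : K) : ∃ B, IsConj A B ∧ B j j = t ∧ ∀ l m, l ≠ j → m ≠ i → B l m = A l m := by
  refine ⟨_, isConj_transvectionConj hij.symm ((t - A j j) / A i j) A, ?_, fun l m hl hm ↦ ?_⟩
  · simp [transvectionConj, hij.symm, div_mul_cancel₀ _ hA]
  · simp [transvectionConj, hl, hm]

lemma exists_isConj_row_apply_ne_zero {A : Matrix ι ι K} {i j m : ι} (hij : i ≠ j) (hmj : m ≠ j)
    (hA : A i j ≠ 0) :
    ∃ B, IsConj A B ∧ B i j ≠ 0 ∧ B i m ≠ 0 ∧ ∀ l, l ≠ j → l ≠ m → B l l = A l l := by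
  by_cases hm : A i m = 0
  · refine ⟨_, isConj_transvectionConj hmj.symm 1 A, ?_, ?_, fun l hlj hlm ↦ ?_⟩
    · simpa [transvectionConj, hij, hmj.symm] using hA
    · simpa [transvectionConj, hij, hm] using hA
    · simp [transvectionConj, hlj, hlm]
  · exact ⟨A, .refl A, hA, hm, fun _ _ _ ↦ rfl⟩

/-- One diagonal entry after the other is corrected; `S` is the set of those still to be treated,
and a nonzero off-diagonal entry inside `S × S` drives the next correction. -/
lemma exists_isConj_diag_eq_of_apply_ne_zero {γ : ι → K} (S : Finset ι) :
    ∀ {A : Matrix ι ι K} {i j : ι}, i ∈ S → j ∈ S → i ≠ j → A i j ≠ 0 → ∑ l, γ l = A.trace →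
      (∀ l ∉ S, A l l = γ l) → ∃ B, IsConj A B ∧ B.diag = γ := by
  induction S using Finset.strongInduction with
  | H S ih =>
    intro A i j hi hj hij hA htr hS
    by_cases hm : ∃ m ∈ S, m ≠ i ∧ m ≠ j
    · obtain ⟨m, hm, hmi, hmj⟩ := hm
      obtain ⟨B, hAB, hBj, hBm, hB⟩ := exists_isConj_row_apply_ne_zero hij hmj hA
      obtain ⟨C, hBC, hCj, hC⟩ := exists_isConj_apply_self_eq hij hBj (γ j)
      have hAC := hAB.trans hBC
      obtain ⟨D, hCD, hD⟩ := ih (S.erase j) (Finset.erase_ssubset hj)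
        (Finset.mem_erase.mpr ⟨hij, hi⟩) (Finset.mem_erase.mpr ⟨hmj, hm⟩) hmi.symm
        (by rwa [hC i m hij hmi]) (htr.trans (trace_eq_of_isConj hAC)) fun l hl ↦ by
          obtain rfl | hlj := eq_or_ne l j
          · exact hCj
          have hlS : l ∉ S := fun h ↦ hl (Finset.mem_erase.mpr ⟨hlj, h⟩)
          rw [hC l l hlj (ne_of_mem_of_not_mem hi hlS).symm,
            hB l hlj (ne_of_mem_of_not_mem hm hlS).symm, hS l hlS]
      exact ⟨D, hAC.trans hCD, hD⟩
    · push Not at hm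
      obtain ⟨B, hAB, hBj, hB⟩ := exists_isConj_apply_self_eq hij hA (γ j)
      have hBγ (l : ι) (hl : l ≠ i) : B l l = γ l := by
        obtain rfl | hlj := eq_or_ne l j
        · exact hBj
        · rw [hB l l hlj hl, hS l fun h ↦ hlj (hm l h hl)]
      have hBi : B i i = γ i := by
        rw [trace_eq_of_isConj hAB, trace, ← Finset.add_sum_erase _ _ (Finset.mem_univ i),
          ← Finset.add_sum_erase _ _ (Finset.mem_univ i),
          Finset.sum_congr rfl fun l hl ↦ (hBγ l (Finset.ne_of_mem_erase hl)).symm] at htr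
        exact (add_right_cancel htr).symm
      refine ⟨B, hAB, funext fun l ↦ ?_⟩
      obtain rfl | hl := eq_or_ne l i
      · exact hBi
      · exact hBγ l hl

theorem exists_isConj_diag_eq {A : Matrix ι ι K} (hA : A ∉ Set.range (scalar ι)) {γ : ι → K}
    (hγ : ∑ i, γ i = A.trace) : ∃ B, IsConj A B ∧ B.diag = γ := by
  obtain ⟨B, i, j, hAB, hij, hB⟩ := exists_isConj_apply_ne_zero hA
  obtain ⟨C, hBC, hC⟩ := exists_isConj_diag_eq_of_apply_ne_zero Finset.univ (Finset.mem_univ i)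
    (Finset.mem_univ j) hij hB (hγ.trans (trace_eq_of_isConj hAB)) (by simp)
  exact ⟨C, hAB.trans hBC, hC⟩

end Diagonal

section Root

open Polynomial

lemma exists_pow_eq_of_isNilpotent_pow_sub {S : Type*} [CommRing S] {k : ℕ}
    (hk : IsUnit (k : S)) {s x : S} (hs : IsUnit s) (hx : IsNilpotent (x ^ k - s)) :
    ∃ y, y ^ k = s := by
  obtain rfl | hk0 := eq_or_ne k 0
  · have : Subsingleton S := subsingleton_of_zero_eq_one (by simpa using hk)
    exact ⟨1, Subsingleton.elim _ _⟩
  have hxu : IsUnit x := by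
    rw [← isUnit_pow_iff hk0, ← sub_add_cancel (x ^ k) s]
    exact hx.isUnit_add_right_of_commute hs (.all _ _)
  let P : S[X] := X ^ k - C s
  have hP (y : S) : aeval y P = y ^ k - s := by simp [P]
  have hP' : IsUnit (aeval x (derivative P)) := by
    have : aeval x (derivative P) = k * x ^ (k - 1) := by
      simp only [P, derivative_sub, derivative_X_pow, derivative_C, sub_zero, map_mul, map_pow,
        aeval_X, map_natCast]
    exact this ▸ hk.mul (hxu.pow (k - 1))
  obtain ⟨y, ⟨-, hy⟩, -⟩ := existsUnique_nilpotent_sub_and_aeval_eq_zero ((hP x).symm ▸ hx) hP'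
  exact ⟨y, sub_eq_zero.mp ((hP y).symm.trans hy)⟩

variable {F : Type*} [Field F]

lemma dvd_pow_natDegree_of_forall_isRoot {f g : F[X]} (hf : f.Splits)
    (h : ∀ a, f.IsRoot a → g.IsRoot a) (hf0 : f ≠ 0) : f ∣ g ^ f.natDegree := by
  rw [hf.natDegree_eq_card_roots]
  nth_rw 1 [hf.eq_prod_roots]
  rw [C_mul_dvd (leadingCoeff_ne_zero.mpr hf0), ← Multiset.prod_replicate, ← Multiset.map_const']
  exact Multiset.prod_dvd_prod_of_dvd _ _ fun a ha ↦
    dvd_iff_isRoot.mpr (h a (isRoot_of_mem_roots ha))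

lemma exists_dvd_pow_sub_X {k : ℕ} (hk : (k : F) ≠ 0) {f : F[X]} (hf : f.Splits)
    (hroot : ∀ a, f.IsRoot a → ∃ r : Fˣ, (r : F) ^ k = a) : ∃ h : F[X], f ∣ h ^ k - X := by
  classical
  have h0 : ¬ f.IsRoot 0 := fun h ↦ by
    obtain ⟨r, hr⟩ := hroot 0 h
    exact (r.isUnit.pow k).ne_zero hr
  have hf0 : f ≠ 0 := by
    rintro rfl
    exact h0 (by simp)
  choose! r hr using hroot
  let g : F[X] := Lagrange.interpolate f.roots.toFinset id (fun a ↦ (r a : F))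
  have hg (a : F) (ha : f.IsRoot a) : g.eval a = r a :=
    Lagrange.eval_interpolate_at_node _ Function.injective_id.injOn (by simpa [hf0] using ha)
  have hnil : IsNilpotent (AdjoinRoot.mk f g ^ k - AdjoinRoot.root f) := by
    refine ⟨f.natDegree, ?_⟩
    rw [← AdjoinRoot.mk_X, ← map_pow, ← map_sub, ← map_pow, AdjoinRoot.mk_eq_zero]
    exact dvd_pow_natDegree_of_forall_isRoot hf (fun a ha ↦ by simp [hg a ha, hr a ha]) hf0
  have hroot : IsUnit (AdjoinRoot.root f) := by
    obtain ⟨u, v, huv⟩ : IsCoprime X f := irreducible_X.coprime_iff_not_dvd.mpr (by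
      rwa [X_dvd_iff, coeff_zero_eq_eval_zero])
    have := congrArg (AdjoinRoot.mk f) huv
    exact .of_mul_eq_one_right (AdjoinRoot.mk f u) (by simpa using this)
  have hkS : IsUnit (k : AdjoinRoot f) := by
    simpa using hk.isUnit.map (algebraMap F (AdjoinRoot f))
  obtain ⟨y, hy⟩ := exists_pow_eq_of_isNilpotent_pow_sub hkS hroot hnil
  obtain ⟨h, rfl⟩ := AdjoinRoot.mk_surjective y
  exact ⟨h, by rwa [← map_pow, ← AdjoinRoot.mk_X, AdjoinRoot.mk_eq_mk] at hy⟩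

theorem exists_isUnit_pow_eq_of_isUpperTriangular {ι : Type*} [Fintype ι] [LinearOrder ι] {k : ℕ}
    (hk : (k : F) ≠ 0) {A : Matrix ι ι F} (hA : A.IsUpperTriangular)
    (hdiag : ∀ i, ∃ r : Fˣ, (r : F) ^ k = A i i) : ∃ B : Matrix ι ι F, IsUnit B ∧ B ^ k = A := by
  have hchar := Matrix.charpoly_of_isUpperTriangular A hA
  obtain ⟨h, hdvd⟩ := exists_dvd_pow_sub_X hk (f := A.charpoly)
    (hchar ▸ Splits.prod fun i _ ↦ .X_sub_C _) fun a ha ↦ by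
      obtain ⟨i, -, hi⟩ := Finset.prod_eq_zero_iff.mp ((eval_prod _ _ _).symm.trans (hchar ▸ ha))
      have haA : a = A i i := by simpa [sub_eq_zero] using hi
      exact haA ▸ hdiag i
  have hpow : aeval A h ^ k = A := by
    obtain ⟨g, hg⟩ := hdvd
    have := congrArg (aeval A) hg
    rwa [map_mul, Matrix.aeval_self_charpoly, zero_mul, map_sub, map_pow, aeval_X,
      sub_eq_zero] at this
  have hk0 : k ≠ 0 := by
    rintro rfl
    simp at hk
  refine ⟨aeval A h, ?_, hpow⟩
  rw [← isUnit_pow_iff hk0, hpow, Matrix.isUnit_iff_isUnit_det, Matrix.det_of_isUpperTriangular hA,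
    IsUnit.prod_univ_iff]
  intro i
  obtain ⟨r, hr⟩ := hdiag i
  exact hr ▸ r.isUnit.pow k

end Root

section Nonscalar

open Matrix

lemma exists_isUpperTriangular_add_transpose {ι R : Type*} [LinearOrder ι] [AddZeroClass R]
    {A : Matrix ι ι R} {x y : ι → R} (hA : ∀ i, x i + y i = A i i) :
    ∃ U V : Matrix ι ι R, U.IsUpperTriangular ∧ V.IsUpperTriangular ∧ U.diag = x ∧ V.diag = y ∧
      U + Vᵀ = A := by
  refine ⟨of fun i j ↦ if i < j then A i j else if i = j then x i else 0,
    of fun i j ↦ if i < j then A j i else if i = j then y i else 0,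
    fun i j h ↦ ?_, fun i j h ↦ ?_, ?_, ?_, ?_⟩
  · have h : j < i := h
    simp [h.not_gt, h.ne']
  · have h : j < i := h
    simp [h.not_gt, h.ne']
  · ext i
    simp
  · ext i
    simp
  · ext i j
    rcases lt_trichotomy i j with h | rfl | h
    · simp [h, h.not_gt, h.ne']
    · simp [hA]
    · simp [h, h.not_gt, h.ne']

lemma mem_sumTwoInvertiblePowers_of_isConj {k n : ℕ} {R : Type*} [CommRing R]
    {M N : Matrix (Fin n) (Fin n) R} (hMN : IsConj M N) (hM : M ∈ sumTwoInvertiblePowers k n R) :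
    N ∈ sumTwoInvertiblePowers k n R := by
  obtain ⟨A, B, hA, hB, rfl⟩ := hM
  obtain ⟨c, hc⟩ := hMN
  refine ⟨c * A * ↑c⁻¹, c * B * ↑c⁻¹, (c.isUnit.mul hA).mul c⁻¹.isUnit,
    (c.isUnit.mul hB).mul c⁻¹.isUnit, ?_⟩
  rw [Units.conj_pow, Units.conj_pow, ← add_mul, ← mul_add, hc.eq, mul_assoc, Units.mul_inv,
    mul_one]

variable {K : Type*} [Field K] {k n : ℕ}

theorem mem_sumTwoInvertiblePowers_of_notMem_range_scalar (hk : (k : K) ≠ 0)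
    {M : Matrix (Fin n) (Fin n) K} (hM : M ∉ Set.range (scalar (Fin n))) {x y : Fin n → Kˣ}
    (htr : ∑ i, ((x i : K) ^ k + (y i : K) ^ k) = M.trace) :
    M ∈ sumTwoInvertiblePowers k n K := by
  obtain ⟨N, hMN, hN⟩ := exists_isConj_diag_eq hM htr
  obtain ⟨U, V, hU, hV, hUx, hVy, hUV⟩ :=
    exists_isUpperTriangular_add_transpose (A := N) fun i ↦ (congrFun hN i).symm
  obtain ⟨A, hA, hAU⟩ := exists_isUnit_pow_eq_of_isUpperTriangular hk hU
    fun i ↦ ⟨x i, (congrFun hUx i).symm⟩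
  obtain ⟨B, hB, hBV⟩ := exists_isUnit_pow_eq_of_isUpperTriangular hk hV
    fun i ↦ ⟨y i, (congrFun hVy i).symm⟩
  refine mem_sumTwoInvertiblePowers_of_isConj hMN.symm
    ⟨A, Bᵀ, hA, (isUnit_transpose B).mpr hB, ?_⟩
  rw [← transpose_pow, hAU, hBV, hUV]

end Nonscalar

section CharacterSums

variable {F : Type*} [Field F]

section Finite

variable [Finite F]

lemma norm_mulChar_apply (χ : MulChar F ℂ) {a : F} (ha : a ≠ 0) : ‖χ a‖ = 1 := by
  classical
  have := Fintype.ofFinite F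
  lift a to Fˣ using ha.isUnit
  exact Complex.norm_eq_one_of_mem_rootsOfUnity (χ.apply_mem_rootsOfUnity a)

variable (F) in
/-- The complex multiplicative characters of `F` whose order divides `k`. -/
noncomputable def torsionMulChars (k : ℕ) : Finset (MulChar F ℂ) :=
  (Set.toFinite {χ | χ ^ k = 1}).toFinset

lemma mem_torsionMulChars {k : ℕ} {χ : MulChar F ℂ} : χ ∈ torsionMulChars F k ↔ χ ^ k = 1 := by
  simp [torsionMulChars]

lemma card_torsionMulChars (k : ℕ) :
    (torsionMulChars F k).card = Nat.gcd k (Nat.card F - 1) := by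
  obtain ⟨e⟩ := MulChar.mulEquiv_units F ℂ
  have : IsCyclic (MulChar F ℂ) := isCyclic_of_surjective e.symm e.symm.surjective
  rw [torsionMulChars, ← Set.ncard_eq_toFinset_card, ← Nat.card_units,
    ← MulChar.card_eq_card_units_of_hasEnoughRootsOfUnity F ℂ,
    Nat.gcd_comm, ← IsCyclic.card_powMonoidHom_ker]
  rfl

lemma exists_pow_eq_of_forall_mulChar_apply_eq_one {k : ℕ} {u : Fˣ}
    (h : ∀ χ ∈ torsionMulChars F k, χ u = 1) : ∃ x : Fˣ, x ^ k = u := by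
  let H : Subgroup Fˣ := (powMonoidHom k).range
  suffices u ∈ H from this
  rw [← (MulChar.subgroupOrderIsoSubgroupMulChar F ℂ).symm_apply_apply H]
  refine MulChar.mem_subgroupOrderIsoSubgroupMulChar_symm_iff.mpr fun χ hχ ↦ h χ ?_
  rw [mem_torsionMulChars]
  ext x
  rw [MulChar.pow_apply_coe, MulChar.one_apply_coe, ← map_pow]
  exact MulChar.mem_subgroupOrderIsoSubgroupMulChar_iff.mp hχ (x ^ k) ⟨x, rfl⟩

/-- The number of `k`-th roots of `u` in `Fˣ`, as a sum over characters. It is complex-valued so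
that convolutions of it expand into Jacobi sums, and it vanishes at `u = 0`. -/
noncomputable def rootCount (k : ℕ) (u : F) : ℂ := ∑ χ ∈ torsionMulChars F k, χ u

lemma exists_units_pow_eq_of_rootCount_ne_zero {k : ℕ} {u : F} (hu : rootCount k u ≠ 0) :
    ∃ x : Fˣ, (x : F) ^ k = u := by
  have hu0 : u ≠ 0 := by
    rintro rfl
    simp [rootCount, MulCharClass.map_nonunit] at hu
  lift u to Fˣ using hu0.isUnit
  suffices ∃ x : Fˣ, x ^ k = u from this.imp fun x hx ↦ mod_cast congrArg Units.val hx
  refine exists_pow_eq_of_forall_mulChar_apply_eq_one fun χ hχ ↦ ?_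
  have hmul : χ u * rootCount k (u : F) = rootCount k (u : F) := by
    rw [rootCount, Finset.mul_sum]
    refine Finset.sum_equiv (Equiv.mulLeft χ) (fun ψ ↦ ?_) fun ψ _ ↦ ?_
    · simp [mem_torsionMulChars, mul_pow, mem_torsionMulChars.mp hχ]
    · simp
  exact (mul_eq_right₀ hu).mp hmul

lemma norm_rootCount_le (k : ℕ) {a : F} (ha : a ≠ 0) :
    ‖rootCount k a‖ ≤ (torsionMulChars F k).card := by
  simpa [rootCount] using norm_sum_le_of_le _ fun χ _ ↦ (norm_mulChar_apply χ ha).le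

end Finite

section Fintype

variable [Fintype F]

lemma norm_jacobiSum {χ φ : MulChar F ℂ} (hχ : χ ≠ 1) (hφ : φ ≠ 1) (hχφ : χ * φ ≠ 1) :
    ‖jacobiSum χ φ‖ = √(Fintype.card F : ℝ) := by
  have hchar : ringChar ℂ ≠ ringChar F := by
    rw [ringChar.eq_zero]
    exact (CharP.ringChar_ne_zero_of_finite F).symm
  have hconj : jacobiSum χ⁻¹ φ⁻¹ = starRingEnd ℂ (jacobiSum χ φ) := by
    rw [← jacobiSum_ringHomComp, ← MulChar.star_eq_inv, ← MulChar.star_eq_inv]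
    rfl
  have h := jacobiSum_mul_jacobiSum_inv hchar hχ hφ hχφ
  rw [hconj, Complex.mul_conj, Complex.normSq_eq_norm_sq] at h
  rw [← Real.sqrt_sq (norm_nonneg (jacobiSum χ φ))]
  exact congrArg Real.sqrt (by exact_mod_cast h)

lemma sum_mulChar_mul_mulChar_sub {R : Type*} [CommRing R] (χ φ : MulChar F R) {a : F}
    (ha : a ≠ 0) : ∑ u, χ u * φ (a - u) = χ a * φ a * jacobiSum χ φ := by
  rw [jacobiSum, Finset.mul_sum, ← Equiv.sum_comp (Equiv.mulLeft₀ a ha)]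
  refine Finset.sum_congr rfl fun t _ ↦ ?_
  rw [Equiv.mulLeft₀_apply, ← mul_one_sub, map_mul, map_mul]
  ring

lemma norm_sum_sum_jacobiSum_le {X : Finset (MulChar F ℂ)} (hX : ∀ χ ∈ X, χ ≠ 1)
    (hinv : ∀ χ ∈ X, χ⁻¹ ∈ X) {a : F} (ha : a ≠ 0) :
    ‖∑ χ ∈ X, ∑ φ ∈ X, χ a * φ a * jacobiSum χ φ‖ ≤
      X.card * (1 + (X.card - 1) * √(Fintype.card F : ℝ)) := by
  classical
  have hnorm (χ φ : MulChar F ℂ) : ‖χ a * φ a * jacobiSum χ φ‖ = ‖jacobiSum χ φ‖ := by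
    simp [norm_mulChar_apply _ ha]
  rw [← nsmul_eq_mul, ← Finset.sum_const]
  refine norm_sum_le_of_le _ fun χ hχ ↦ ?_
  have hinvχ : ‖jacobiSum χ χ⁻¹‖ = 1 := by
    rw [jacobiSum_nontrivial_inv (hX χ hχ), norm_neg,
      norm_mulChar_apply _ (neg_ne_zero.mpr one_ne_zero)]
  rw [← Finset.add_sum_erase _ _ (hinv χ hχ), ← Finset.cast_card_erase_of_mem (hinv χ hχ),
    ← nsmul_eq_mul, ← Finset.sum_const]
  refine norm_add_le_of_le ((hnorm _ _).trans hinvχ).le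
    (norm_sum_le_of_le _ fun φ hφ ↦ ((hnorm _ _).trans ?_).le)
  obtain ⟨hφχ, hφ⟩ := Finset.mem_erase.mp hφ
  exact norm_jacobiSum (hX χ hχ) (hX φ hφ) fun h ↦ hφχ (eq_inv_of_mul_eq_one_right h)

lemma norm_sum_rootCount_mul_rootCount_sub_le (k : ℕ) {a : F} (ha : a ≠ 0) {m : ℝ}
    (hm : m = (torsionMulChars F k).card - 1) :
    ‖∑ u, rootCount k u * rootCount k (a - u) - (Fintype.card F - 2 * rootCount k a)‖ ≤
      m * (1 + (m - 1) * √(Fintype.card F : ℝ)) := by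
  classical
  let X := (torsionMulChars F k).erase 1
  have h1 : 1 ∈ torsionMulChars F k := by simp [mem_torsionMulChars]
  have hX (χ) (hχ : χ ∈ X) : χ ≠ 1 := Finset.ne_of_mem_erase hχ
  have hinv (χ) (hχ : χ ∈ X) : χ⁻¹ ∈ X := by
    simpa [X, mem_torsionMulChars] using hχ
  have hsplit (f : MulChar F ℂ → ℂ) : ∑ χ ∈ torsionMulChars F k, f χ = f 1 + ∑ χ ∈ X, f χ :=
    (Finset.add_sum_erase _ _ h1).symm
  have h1a : (1 : MulChar F ℂ) a = 1 := MulChar.one_apply ha.isUnit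
  have hT : ∑ u, rootCount k u * rootCount k (a - u) =
      ∑ χ ∈ torsionMulChars F k, ∑ φ ∈ torsionMulChars F k, χ a * φ a * jacobiSum χ φ := by
    simp_rw [rootCount, Finset.sum_mul_sum, ← sum_mulChar_mul_mulChar_sub _ _ ha]
    rw [Finset.sum_comm]
    exact Finset.sum_congr rfl fun χ _ ↦ Finset.sum_comm
  -- The pairs `(χ, φ)` with a trivial entry contribute exactly `q - 2 * rootCount k a`.
  have hrow : ∑ φ ∈ X, 1 * φ a * jacobiSum 1 φ = -∑ φ ∈ X, φ a := by
    rw [← Finset.sum_neg_distrib]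
    exact Finset.sum_congr rfl fun φ hφ ↦ by simp [jacobiSum_one_nontrivial (hX φ hφ)]
  have hcol : ∑ χ ∈ X, χ a * 1 * jacobiSum χ 1 = -∑ χ ∈ X, χ a := by
    rw [← hrow]
    exact Finset.sum_congr rfl fun χ _ ↦ by rw [jacobiSum_comm, mul_comm (χ a)]
  have hmain : ∑ u, rootCount k u * rootCount k (a - u) - (Fintype.card F - 2 * rootCount k a) =
      ∑ χ ∈ X, ∑ φ ∈ X, χ a * φ a * jacobiSum χ φ := by
    simp_rw [hT, rootCount, hsplit, Finset.sum_add_distrib, h1a, hrow, hcol, jacobiSum_one_one]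
    ring
  rw [hmain, hm, ← Finset.cast_card_erase_of_mem h1]
  exact norm_sum_sum_jacobiSum_le hX hinv ha

end Fintype

lemma mul_one_add_mul_sqrt_lt {m c q : ℝ} (hm : 0 ≤ m) (hc : 0 ≤ c) (hq : 1 ≤ q)
    (h : m ^ 4 + 2 * c < q) : m * (1 + (m - 1) * √q) < q - c := by
  have hs : √q ^ 2 = q := Real.sq_sqrt (zero_le_one.trans hq)
  have hs1 : 1 ≤ √q := Real.one_le_sqrt.mpr hq
  have hms : m ^ 2 < √q := Real.lt_sqrt_of_sq_lt (by linarith [pow_mul m 2 2])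
  have hcs : 2 * c < 2 * (√q * (√q - m ^ 2)) := calc
    2 * c < (√q - m ^ 2) * (√q + m ^ 2) := by linarith [sq_sub_sq (√q) (m ^ 2), pow_mul m 2 2]
    _ ≤ (√q - m ^ 2) * (√q + √q) := by gcongr
    _ = 2 * (√q * (√q - m ^ 2)) := by ring
  calc m * (1 + (m - 1) * √q) ≤ m * (√q + (m - 1) * √q) := by gcongr
    _ = √q ^ 2 - √q * (√q - m ^ 2) := by ring
    _ < q - c := by linarith

variable [Finite F]

theorem exists_units_pow_add_pow_eq_of_norm_rootCount {k : ℕ} {a : F} (ha : a ≠ 0)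
    (h : ((Nat.gcd k (Nat.card F - 1) - 1 : ℕ) : ℝ) ^ 4 + 4 * ‖rootCount k a‖ <
      Nat.card F) :
    ∃ x y : Fˣ, (x : F) ^ k + (y : F) ^ k = a := by
  have hm : ((Nat.gcd k (Nat.card F - 1) - 1 : ℕ) : ℝ) = (torsionMulChars F k).card - 1 := by
    rw [card_torsionMulChars, Nat.cast_pred]
    exact Nat.gcd_pos_of_pos_right _ (Nat.sub_pos_of_lt Finite.one_lt_card)
  have := Fintype.ofFinite F
  rw [Nat.card_eq_fintype_card] at h hm
  have hT : ∑ u, rootCount k u * rootCount k (a - u) ≠ 0 := by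
    intro hT
    have hle := norm_sum_rootCount_mul_rootCount_sub_le k ha hm
    have hlt := mul_one_add_mul_sqrt_lt (m := (Nat.gcd k (Fintype.card F - 1) - 1 : ℕ))
      (c := 2 * ‖rootCount k a‖) (q := Fintype.card F) (Nat.cast_nonneg _) (by positivity)
      (mod_cast Fintype.card_pos) (by linarith)
    have hge := norm_sub_norm_le (Fintype.card F : ℂ) (2 * rootCount k a)
    rw [hT, zero_sub, norm_neg] at hle
    rw [norm_mul, Complex.norm_natCast, Complex.norm_ofNat] at hge
    linarith
  obtain ⟨u, -, hu⟩ := Finset.exists_ne_zero_of_sum_ne_zero hT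
  obtain ⟨x, hx⟩ := exists_units_pow_eq_of_rootCount_ne_zero (left_ne_zero_of_mul hu)
  obtain ⟨y, hy⟩ := exists_units_pow_eq_of_rootCount_ne_zero (right_ne_zero_of_mul hu)
  exact ⟨x, y, by rw [hx, hy, add_sub_cancel]⟩

theorem exists_units_pow_add_pow_eq {k : ℕ}
    (h : (Nat.gcd k (Nat.card F - 1) - 1) ^ 4 + 4 * Nat.gcd k (Nat.card F - 1) <
      Nat.card F) {a : F} (ha : a ≠ 0) :
    ∃ x y : Fˣ, (x : F) ^ k + (y : F) ^ k = a := by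
  refine exists_units_pow_add_pow_eq_of_norm_rootCount ha (lt_of_le_of_lt ?_ (Nat.cast_lt.mpr h))
  push_cast
  gcongr
  exact card_torsionMulChars (F := F) k ▸ norm_rootCount_le k ha

theorem exists_pow_add_pow_eq {k : ℕ} (hk : k ≠ 0)
    (h : (Nat.gcd k (Nat.card F - 1) - 1) ^ 4 < Nat.card F) (a : F) :
    ∃ x y : F, x ^ k + y ^ k = a := by
  by_cases ha : ∃ x : F, x ^ k = a
  · obtain ⟨x, hx⟩ := ha
    exact ⟨x, 0, by rw [hx, zero_pow hk, add_zero]⟩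
  have ha0 : a ≠ 0 := fun ha0 ↦ ha ⟨0, by rw [ha0, zero_pow hk]⟩
  have hcount : rootCount k a = 0 := by
    by_contra hcount
    obtain ⟨x, hx⟩ := exists_units_pow_eq_of_rootCount_ne_zero hcount
    exact ha ⟨x, hx⟩
  obtain ⟨x, y, hxy⟩ := exists_units_pow_add_pow_eq_of_norm_rootCount (k := k) ha0
    (by rw [hcount]; simpa using Nat.cast_lt (α := ℝ) |>.mpr h)
  exact ⟨x, y, hxy⟩

theorem exists_units_pow_eq_neg_one {k : ℕ}
    (h : Even (Nat.card F * ((Nat.card F - 1) / Nat.gcd k (Nat.card F - 1)))) :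
    ∃ x : Fˣ, (x : F) ^ k = -1 := by
  classical
  obtain hq | hd := Nat.even_mul.mp h
  · have := Fintype.ofFinite F
    rw [Nat.card_eq_fintype_card, Nat.even_iff, ← FiniteField.even_card_iff_char_two] at hq
    have : CharP F 2 := ringChar.of_eq hq
    exact ⟨1, by simp [CharTwo.neg_eq]⟩
  have hcard : 2 ∣ Nat.card (powMonoidHom k : Fˣ →* Fˣ).range := by
    rw [IsCyclic.card_powMonoidHom_range, Nat.card_units, Nat.gcd_comm]
    exact hd.two_dvd
  have : Fact (Nat.Prime 2) := ⟨Nat.prime_two⟩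
  obtain ⟨⟨y, hyr⟩, hy⟩ := exists_prime_orderOf_dvd_card' 2 hcard
  obtain ⟨x, rfl⟩ := MonoidHom.mem_range.mp hyr
  rw [Subgroup.orderOf_mk, orderOf_eq_prime_iff] at hy
  have hsq : ((x : F) ^ k) ^ 2 = 1 := by simpa using congrArg Units.val hy.1
  have hne : (x : F) ^ k ≠ 1 := fun hx ↦ hy.2 (Units.ext (by simpa using hx))
  exact ⟨x, (sq_eq_one_iff.mp hsq).resolve_left hne⟩

end CharacterSums

lemma exists_extension_algHom_matrix (K : Type*) [Field K] [Finite K] {n : ℕ} (hn : n ≠ 0) :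
    ∃ (L : Type) (_ : Field L) (_ : Algebra K L),
      Nat.card L = Nat.card K ^ n ∧ Nonempty (L →ₐ[K] Matrix (Fin n) (Fin n) K) := by
  obtain ⟨p, hp⟩ := CharP.exists K
  have : Fact p.Prime := ⟨CharP.char_is_prime K p⟩
  have : NeZero n := ⟨hn⟩
  exact ⟨FiniteField.Extension K p n, inferInstance, inferInstance,
    FiniteField.natCard_extension K p n,
    ⟨Algebra.leftMulMatrix (Module.finBasisOfFinrankEq K _ (FiniteField.finrank_extension K p n))⟩⟩

section Scalar

open Matrix

variable {K : Type*} [Field K] [Finite K] {k n : ℕ}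

theorem scalar_mem_sumTwoPowers (hk : k ≠ 0) (hn : n ≠ 0)
    (h : (powGcd k (Nat.card K) n - 1) ^ 4 < Nat.card K ^ n) (c : K) :
    scalar (Fin n) c ∈ sumTwoPowers k n K := by
  obtain ⟨L, _, _, hL, ⟨f⟩⟩ := exists_extension_algHom_matrix K hn
  have : Finite L := Nat.finite_of_card_ne_zero (by rw [hL]; exact pow_ne_zero n Nat.card_pos.ne')
  rw [powGcd, ← hL] at h
  obtain ⟨x, y, hxy⟩ := exists_pow_add_pow_eq hk h (algebraMap K L c)
  exact ⟨f x, f y, by rw [← map_pow, ← map_pow, ← map_add, hxy, f.commutes]; rfl⟩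

theorem scalar_mem_sumTwoInvertiblePowers (hn : n ≠ 0)
    (h : (powGcd k (Nat.card K) n - 1) ^ 4 + 4 * powGcd k (Nat.card K) n < Nat.card K ^ n)
    (heven : Even (Nat.card K * ((Nat.card K ^ n - 1) / powGcd k (Nat.card K) n))) (c : K) :
    scalar (Fin n) c ∈ sumTwoInvertiblePowers k n K := by
  obtain ⟨L, _, _, hL, ⟨f⟩⟩ := exists_extension_algHom_matrix K hn
  have : Finite L := Nat.finite_of_card_ne_zero (by rw [hL]; exact pow_ne_zero n Nat.card_pos.ne')
  rw [Nat.even_mul, ← Nat.even_pow' hn, ← Nat.even_mul, powGcd, ← hL] at heven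
  rw [powGcd, ← hL] at h
  obtain ⟨x, y, hxy⟩ : ∃ x y : Lˣ, (x : L) ^ k + (y : L) ^ k = algebraMap K L c := by
    by_cases hc : c = 0
    · obtain ⟨x, hx⟩ := exists_units_pow_eq_neg_one heven
      exact ⟨x, 1, by simp [hx, hc]⟩
    · exact exists_units_pow_add_pow_eq h (by simpa using hc)
  refine ⟨f x, f y, x.isUnit.map f, y.isUnit.map f, ?_⟩
  rw [← map_pow, ← map_pow, ← map_add, hxy, f.commutes]
  rfl

theorem theorem1p13_general (hk : (k : K) ≠ 0)
    (hsum : ∀ t : K, ∃ x y : Fin n → Kˣ, ∑ i, ((x i : K) ^ k + (y i : K) ^ k) = t) :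
    ((powGcd k (Nat.card K) n - 1) ^ 4 < Nat.card K ^ n → sumTwoPowers k n K = Set.univ) ∧
    ((powGcd k (Nat.card K) n - 1) ^ 4 + 4 * powGcd k (Nat.card K) n < Nat.card K ^ n →
      Even (Nat.card K * ((Nat.card K ^ n - 1) / powGcd k (Nat.card K) n)) →
      sumTwoInvertiblePowers k n K = Set.univ) := by
  have hk0 : k ≠ 0 := fun h ↦ hk (by rw [h, Nat.cast_zero])
  have hn : n ≠ 0 := by
    rintro rfl
    simpa using hsum 1
  have hnonscalar {M : Matrix (Fin n) (Fin n) K} (hM : M ∉ Set.range (scalar (Fin n))) :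
      M ∈ sumTwoInvertiblePowers k n K := by
    obtain ⟨x, y, hxy⟩ := hsum M.trace
    exact mem_sumTwoInvertiblePowers_of_notMem_range_scalar hk hM hxy
  refine ⟨fun h ↦ Set.eq_univ_of_forall fun M ↦ ?_,
    fun h heven ↦ Set.eq_univ_of_forall fun M ↦ ?_⟩ <;>
  by_cases hM : M ∈ Set.range (scalar (Fin n))
  · obtain ⟨c, rfl⟩ := hM
    exact scalar_mem_sumTwoPowers hk0 hn h c
  · obtain ⟨A, B, -, -, hAB⟩ := hnonscalar hM
    exact ⟨A, B, hAB⟩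
  · obtain ⟨c, rfl⟩ := hM
    exact scalar_mem_sumTwoInvertiblePowers hn h heven c
  · exact hnonscalar hM

end Scalar

section PrimeField

lemma exists_units_pow_ne_one {F : Type*} [Field F] [Finite F] {k : ℕ}
    (h : Nat.gcd k (Nat.card F - 1) < Nat.card F - 1) : ∃ r : Fˣ, r ^ k ≠ 1 := by
  have := Fintype.ofFinite F
  by_contra! hr
  rw [Nat.card_eq_fintype_card] at h
  exact h.ne (Nat.gcd_eq_right ((FiniteField.forall_pow_eq_one_iff F k).mp hr))

variable {p k n : ℕ} [Fact p.Prime]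

lemma exists_sum_ite_eq {ι : Type*} [Fintype ι] [DecidableEq ι] (hι : p ≤ Fintype.card ι + 1)
    {s : ZMod p} (hs : s ≠ 1) (t : ZMod p) :
    ∃ T : Finset ι, ∑ i, (if i ∈ T then s else 1) = t := by
  set r : ZMod p := (t - Fintype.card ι) / (s - 1) with hr
  obtain ⟨T, -, hT⟩ := Finset.exists_subset_card_eq (s := (Finset.univ : Finset ι)) (n := r.val)
    (by rw [Finset.card_univ]; have := r.val_lt; lia)
  refine ⟨T, ?_⟩
  have hite (i : ι) : (if i ∈ T then s else 1) = 1 + if i ∈ T then s - 1 else 0 := by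
    split_ifs <;> ring
  simp only [hite, Finset.sum_add_distrib, Finset.sum_ite_mem, Finset.univ_inter,
    Finset.sum_const, hT, Finset.card_univ, nsmul_eq_mul, mul_one]
  rw [ZMod.natCast_zmod_val, hr, div_mul_cancel₀ _ (sub_ne_zero.mpr hs), add_sub_cancel]

lemma exists_sum_units_pow_add_pow_eq (hp : powGcd k p 1 + 1 < p) (hn : ((p : ℝ) - 1) / 2 < n)
    (t : ZMod p) :
    ∃ x y : Fin n → (ZMod p)ˣ, ∑ i, ((x i : ZMod p) ^ k + (y i : ZMod p) ^ k) = t := by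
  obtain ⟨r, hr⟩ : ∃ r : (ZMod p)ˣ, r ^ k ≠ 1 := exists_units_pow_ne_one (by
    rw [Nat.card_zmod]
    rw [powGcd, pow_one] at hp
    lia)
  have hpn : p < 2 * n + 1 := by exact_mod_cast (by linarith : (p : ℝ) < 2 * n + 1)
  obtain ⟨T, hT⟩ := exists_sum_ite_eq (ι := Fin n ⊕ Fin n) (s := (r : ZMod p) ^ k)
    (by rw [Fintype.card_sum, Fintype.card_fin]; lia) (fun h ↦ hr (Units.ext (by simpa using h))) t
  let z (i : Fin n ⊕ Fin n) : (ZMod p)ˣ := if i ∈ T then r else 1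
  have hz (i) : (z i : ZMod p) ^ k = if i ∈ T then (r : ZMod p) ^ k else 1 := by
    simp only [z]
    split_ifs <;> simp
  refine ⟨z ∘ Sum.inl, z ∘ Sum.inr, ?_⟩
  simp only [Function.comp_apply, Finset.sum_add_distrib]
  rw [← Fintype.sum_sum_type fun i ↦ (z i : ZMod p) ^ k]
  simp only [hz, hT]

end PrimeField

lemma lt_pow_of_log_div_log_lt {x b : ℝ} {n : ℕ} (hx : 0 ≤ x) (hb : 1 < b)
    (h : Real.log x / Real.log b < n) : x < b ^ n := by
  obtain rfl | hx := hx.eq_or_lt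
  · positivity
  · rwa [div_lt_iff₀ (Real.log_pos hb), ← Real.log_pow,
      Real.log_lt_log_iff hx (by positivity)] at h

lemma powGcd_sub_one_pow_lt {k q n : ℕ} (hk : 1 ≤ k) (hq : 1 < q)
    (h : 4 * Real.log ((k : ℝ) - 1) / Real.log q < n) : (powGcd k q n - 1) ^ 4 < q ^ n := by
  have hlt : ((k : ℝ) - 1) ^ 4 < q ^ n := lt_pow_of_log_div_log_lt (by positivity)
    (mod_cast hq) (by rw [Real.log_pow]; exact_mod_cast h)
  calc (powGcd k q n - 1) ^ 4 ≤ (k - 1) ^ 4 := by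
        gcongr
        exact Nat.gcd_le_left _ hk
    _ < q ^ n := by
        rw [← Nat.cast_pred hk] at hlt
        exact_mod_cast hlt

lemma powGcd_sub_one_pow_add_lt {k q n : ℕ} (hk : 1 ≤ k) (hq : 1 < q)
    (h : Real.log (((k : ℝ) - 1) ^ 4 + 4 * k) / Real.log q < n) :
    (powGcd k q n - 1) ^ 4 + 4 * powGcd k q n < q ^ n := by
  have hle : powGcd k q n ≤ k := Nat.gcd_le_left _ hk
  have hlt := lt_pow_of_log_div_log_lt (by positivity) (mod_cast hq) h
  calc (powGcd k q n - 1) ^ 4 + 4 * powGcd k q n ≤ (k - 1) ^ 4 + 4 * k := by gcongr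
    _ < q ^ n := by
        rw [← Nat.cast_pred hk] at hlt
        exact_mod_cast hlt

theorem theorem1p13 (p : ℕ) [Fact p.Prime] (k n : ℕ) (hk : 1 ≤ k) (hn : 2 ≤ n)
    (hp : powGcd k p 1 + 1 < p) (hpk : ¬ p ∣ k) :
    (max (((p : ℝ) - 1) / 2) (4 * Real.log ((k : ℝ) - 1) / Real.log (p : ℝ)) < (n : ℝ) →
      sumTwoPowers k n (ZMod p) = Set.univ) ∧
    (max (((p : ℝ) - 1) / 2)
        (Real.log (((k : ℝ) - 1) ^ 4 + 4 * (k : ℝ)) / Real.log (p : ℝ)) < (n : ℝ) →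
      Even (p * ((p ^ n - 1) / powGcd k p n)) →
      sumTwoInvertiblePowers k n (ZMod p) = Set.univ) := by
  have hkp : (k : ZMod p) ≠ 0 := by rwa [Ne, ZMod.natCast_eq_zero_iff]
  have hp1 : 1 < p := Nat.Prime.one_lt Fact.out
  have hgen (h : ((p : ℝ) - 1) / 2 < n) :=
    theorem1p13_general hkp (exists_sum_units_pow_add_pow_eq hp h)
  simp only [Nat.card_zmod, max_lt_iff] at hgen ⊢
  exact ⟨fun h ↦ (hgen h.1).1 (powGcd_sub_one_pow_lt hk hp1 h.2),
    fun h ↦ (hgen h.1).2 (powGcd_sub_one_pow_add_lt hk hp1 h.2)⟩
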